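/- Let $q$ be a prime power and $e\in\{0,\tfrac12,1,\tfrac32,2\}$, where $q$ is a square if $e\in\{\tfrac12,\tfrac32\}$ (these are the parameters of the finite classical polar spaces over $\mathbb F_q$). Let $d\ge 3$ and $1\le j\le d$. For $0\le i\le d$ define $$ C_j(i)=\sum_{h=\max(i-j,0)}^{\min(d-j,i)}(-1)^{i-h}\,q^{\binom{i-h}{2}+\binom{j-i+h}{2}+(j-i+h)e}\begin{bmatrix}d-i\\ d-j-h\end{bmatrix}_q\begin{bmatrix}i\\ h\end{bmatrix}_q, \qquad \begin{bmatrix}n\\ m\end{bmatrix}_q=\prod_{h=0}^{m-1}\frac{q^{n-h}-1}{q^{m-h}-1}, $$ the standard explicit expression for the entries $P_{ij}$ of the eigenmatrix of the dual polar graph $C_q(d,e)$. Then: (i) If $e>1$ or $(j,e)=(d,1)$, then $|C_j(1)|=\max\{|C_j(i)| : 1\le i\le d\}$. (ii) If $e\le 1$, then $|C_j(d)|=\max\{|C_j(i)| : 1\le i\le d\}$. (iii) If $j<d$ and $j$ is odd, then $C_j(d)=\min\{C_j(i) : 0\le i\le d\}$. -/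

import Mathlib

noncomputable section

/-- The Gaussian binomial coefficient with base `q` (for a base `q > 1`), as the product
`∏_{h=0}^{m-1} (q^(n-h) - 1) / (q^(m-h) - 1)`.  If `n < m`, the factor with `h = n` is zero. -/
def gaussBinom (q : ℝ) (n m : ℕ) : ℝ :=
  ∏ h ∈ Finset.range m, (q ^ (n - h) - 1) / (q ^ (m - h) - 1)

/-- The numbers `C_j(i)` (`0 ≤ i, j ≤ d`), the entry in row `i` and column `j` of the
eigenmatrix of the dual polar graph `C_q(d, e)`:
`∑_{h = max(i-j,0)}^{min(d-j,i)} (-1)^(i-h) q^(binom(i-h,2) + binom(j-i+h,2) + (j-i+h)e)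
  [d-i, d-j-h]_q [i, h]_q`.
For `j ≤ d` and `h` in the range of summation no natural number subtraction truncates,
except that `i - j` as the lower limit stands for `max(i-j,0)`; `j-i+h` is `j + h - i`. -/
def dualPolarC (q : ℕ) (d : ℕ) (e : ℝ) (j i : ℕ) : ℝ :=
  ∑ h ∈ Finset.Icc (i - j) (min (d - j) i),
    (-1 : ℝ) ^ (i - h)
      * (q : ℝ) ^ ((((i - h).choose 2 : ℕ) : ℝ) + (((j + h - i).choose 2 : ℕ) : ℝ)
          + ((j + h - i : ℕ) : ℝ) * e)
      * gaussBinom (q : ℝ) (d - i) (d - j - h) * gaussBinom (q : ℝ) i h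

/-- The pairs `(q, e)` that belong to the finite classical polar spaces over the field with `q`
elements: `q` is a prime power, `e` is one of `0, 1/2, 1, 3/2, 2`, and `q` is a square in the
Hermitian cases `e = 1/2` and `e = 3/2`. -/
def IsPolarParameter (q : ℕ) (e : ℝ) : Prop :=
  IsPrimePow q ∧ e ∈ ({0, 1 / 2, 1, 3 / 2, 2} : Set ℝ) ∧ (e = 1 / 2 ∨ e = 3 / 2 → IsSquare q)

end

open Polynomial

/-! With t = q^e, the q-binomial theorem makes C_j(i) the coefficient of X^j in ∏_{a<i} (1 - q^a X)
∏_{b<d-i} (1 + t q^b X), so rows compare as elementary symmetric functions of signed sequences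
(`dualPolarC_eq_coeff`). Bounding entries termwise bounds these functions (`abs_coeff_linProd_le`).

If t ≤ q^i, the a-th entry of row i is at most q^a in absolute value, while row d attains these
bounds with a constant sign. This gives (ii), and (iii) for i ≥ 2 since e ≤ 2. If e > 1, then t ≥
2q, and row 1 beats every later row because halving its entries t q^b outweighs the lost
cancellation (`abs_coeff_polarSeq_le_one`). -/

/-- The polynomial `∏_{a < n} (1 + x_a X)`, whose coefficients are the elementary symmetric
functions of `x_0, …, x_{n-1}`. -/
noncomputable def linProd (x : ℕ → ℝ) (n : ℕ) : ℝ[X] :=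
  ∏ a ∈ Finset.range n, (1 + C (x a) * X)

/-- The product `(q - 1) (q^2 - 1) ⋯ (q^n - 1)`. -/
noncomputable def qFac (q : ℝ) (n : ℕ) : ℝ := ∏ h ∈ Finset.range n, (q ^ (h + 1) - 1)

/-- The sequence `-1, -q, …, -q^(i-1), t, t q, t q^2, …`. -/
noncomputable def polarSeq (q t : ℝ) (i a : ℕ) : ℝ := if a < i then -q ^ a else t * q ^ (a - i)

lemma coeff_mul_linear_succ (p : ℝ[X]) (c : ℝ) (j : ℕ) :
    (p * (1 + C c * X)).coeff (j + 1) = p.coeff (j + 1) + c * p.coeff j := by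
  rw [mul_add, mul_one, coeff_add, show p * (C c * X) = C c * (p * X) by ring, coeff_C_mul,
    coeff_mul_X]

lemma coeff_mul_linear_zero (p : ℝ[X]) (c : ℝ) : (p * (1 + C c * X)).coeff 0 = p.coeff 0 := by
  simp [mul_coeff_zero]

lemma linProd_succ (x : ℕ → ℝ) (n : ℕ) : linProd x (n + 1) = linProd x n * (1 + C (x n) * X) :=
  Finset.prod_range_succ _ _

lemma linProd_succ' (x : ℕ → ℝ) (n : ℕ) :
    linProd x (n + 1) = linProd (fun a => x (a + 1)) n * (1 + C (x 0) * X) :=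
  Finset.prod_range_succ' _ _

lemma linProd_congr {x y : ℕ → ℝ} {n : ℕ} (h : ∀ a < n, x a = y a) : linProd x n = linProd y n :=
  Finset.prod_congr rfl fun a ha => by rw [h a (Finset.mem_range.1 ha)]

lemma coeff_linProd_zero (x : ℕ → ℝ) (n : ℕ) : (linProd x n).coeff 0 = 1 := by
  induction n with
  | zero => simp [linProd]
  | succ n ih => rw [linProd_succ, coeff_mul_linear_zero, ih]

lemma coeff_linProd_of_lt (x : ℕ → ℝ) {n j : ℕ} (h : n < j) : (linProd x n).coeff j = 0 := by
  induction n generalizing j with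
  | zero => simp [linProd, coeff_one, h.ne']
  | succ n ih =>
    obtain ⟨j, rfl⟩ : ∃ k, j = k + 1 := ⟨j - 1, by omega⟩
    rw [linProd_succ, coeff_mul_linear_succ, ih (by omega), ih (by omega)]
    simp

lemma abs_coeff_linProd_le {x y : ℕ → ℝ} {n : ℕ} (h : ∀ a < n, |x a| ≤ y a) (j : ℕ) :
    |(linProd x n).coeff j| ≤ (linProd y n).coeff j := by
  induction n generalizing j with
  | zero => simp only [linProd, Finset.range_zero, Finset.prod_empty, coeff_one]; split <;> simp
  | succ n ih =>
    have ih' := fun k => ih (fun a ha => h a (by omega)) k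
    cases j with
    | zero => simp [coeff_linProd_zero]
    | succ j =>
      rw [linProd_succ, linProd_succ, coeff_mul_linear_succ, coeff_mul_linear_succ]
      refine (abs_add_le _ _).trans (add_le_add (ih' _) ?_)
      rw [abs_mul]
      exact mul_le_mul (h n (by omega)) (ih' j) (abs_nonneg _)
        ((abs_nonneg _).trans (h n (by omega)))

lemma coeff_linProd_nonneg {x : ℕ → ℝ} {n : ℕ} (h : ∀ a < n, 0 ≤ x a) (j : ℕ) :
    0 ≤ (linProd x n).coeff j :=
  (abs_nonneg _).trans (abs_coeff_linProd_le (fun a ha => (abs_of_nonneg (h a ha)).le) j)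

/-! ### Gaussian binomials and the q-binomial theorem -/

lemma qFac_succ (q : ℝ) (n : ℕ) : qFac q (n + 1) = qFac q n * (q ^ (n + 1) - 1) :=
  Finset.prod_range_succ _ _

lemma qFac_pos {q : ℝ} (hq : 1 < q) (n : ℕ) : 0 < qFac q n :=
  Finset.prod_pos fun h _ => sub_pos.2 (one_lt_pow₀ hq (by omega))

lemma prod_mul_qFac_sub (q : ℝ) {n m : ℕ} (h : m ≤ n) :
    (∏ k ∈ Finset.range m, (q ^ (n - k) - 1)) * qFac q (n - m) = qFac q n := by
  induction m with
  | zero => simp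
  | succ m ih =>
    rw [Finset.prod_range_succ, ← ih (by omega), mul_assoc]
    congr 1
    rw [show n - m = n - (m + 1) + 1 by omega, qFac_succ, mul_comm]

lemma gaussBinom_eq_div {q : ℝ} (hq : 1 < q) {n m : ℕ} (h : m ≤ n) :
    gaussBinom q n m = qFac q n / (qFac q m * qFac q (n - m)) := by
  have h1 := prod_mul_qFac_sub q h
  have h2 := prod_mul_qFac_sub q (le_refl m)
  have h3 := (qFac_pos hq (n - m)).ne'
  have h4 := (qFac_pos hq m).ne'
  rw [Nat.sub_self, show qFac q 0 = 1 by simp [qFac], mul_one] at h2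
  rw [gaussBinom, Finset.prod_div_distrib, h2, ← h1]
  field_simp

lemma gaussBinom_symm {q : ℝ} (hq : 1 < q) {n m : ℕ} (h : m ≤ n) :
    gaussBinom q n (n - m) = gaussBinom q n m := by
  rw [gaussBinom_eq_div hq h, gaussBinom_eq_div hq (Nat.sub_le n m), Nat.sub_sub_self h,
    mul_comm (qFac q m)]

lemma gaussBinom_of_lt (q : ℝ) {n m : ℕ} (h : n < m) : gaussBinom q n m = 0 :=
  Finset.prod_eq_zero (Finset.mem_range.2 h) (by simp)

/-- With denominators cleared, the induction step is a polynomial identity. -/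
lemma coeff_linProd_geom_mul_qFac (q t : ℝ) {n k : ℕ} (h : k ≤ n) :
    (linProd (fun a => t * q ^ a) n).coeff k * (qFac q k * qFac q (n - k))
      = q ^ k.choose 2 * t ^ k * qFac q n := by
  induction n generalizing k with
  | zero =>
    obtain rfl : k = 0 := by omega
    simp [linProd, qFac]
  | succ n ih =>
    cases k with
    | zero => simp [coeff_linProd_zero, qFac]
    | succ k =>
      rw [linProd_succ, coeff_mul_linear_succ]
      have ihk := ih (k := k) (by omega)
      have hc : (k + 1).choose 2 = k + k.choose 2 := by
        rw [Nat.choose_succ_succ' k 1, Nat.choose_one_right]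
      rcases Nat.lt_or_ge k n with hk | hk
      · obtain ⟨m, rfl⟩ : ∃ m, n = k + 1 + m := ⟨n - (k + 1), by omega⟩
        have ihk' := ih (k := k + 1) (by omega)
        rw [show k + 1 + m - k = m + 1 by omega] at ihk
        rw [show k + 1 + m - (k + 1) = m by omega] at ihk'
        rw [show k + 1 + m + 1 - (k + 1) = m + 1 by omega]
        rw [hc] at ihk' ⊢
        rw [qFac_succ q m] at ihk ⊢
        rw [qFac_succ q (k + 1 + m)]
        rw [qFac_succ q k] at ihk' ⊢
        linear_combination (q ^ (m + 1) - 1) * ihk' + t * q ^ (k + 1 + m) * (q ^ (k + 1) - 1) * ihk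
      · obtain rfl : k = n := by omega
        rw [coeff_linProd_of_lt _ (Nat.lt_succ_self k)]
        rw [Nat.sub_self] at ihk ⊢
        rw [hc, qFac_succ q k]
        linear_combination t * q ^ k * (q ^ (k + 1) - 1) * ihk

/-- The `q`-binomial theorem. -/
lemma coeff_linProd_geom {q : ℝ} (hq : 1 < q) (t : ℝ) (n k : ℕ) :
    (linProd (fun a => t * q ^ a) n).coeff k = q ^ k.choose 2 * t ^ k * gaussBinom q n k := by
  rcases Nat.lt_or_ge n k with h | h
  · rw [coeff_linProd_of_lt _ h, gaussBinom_of_lt q h, mul_zero]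
  · have h1 := (qFac_pos hq k).ne'
    have h2 := (qFac_pos hq (n - k)).ne'
    rw [gaussBinom_eq_div hq h, ← mul_div_assoc, eq_div_iff (mul_ne_zero h1 h2)]
    exact coeff_linProd_geom_mul_qFac q t h

lemma linProd_polarSeq (q t : ℝ) {d i : ℕ} (h : i ≤ d) :
    linProd (polarSeq q t i) d
      = linProd (fun a => -1 * q ^ a) i * linProd (fun a => t * q ^ a) (d - i) := by
  obtain ⟨n, rfl⟩ := Nat.exists_eq_add_of_le h
  rw [Nat.add_sub_cancel_left, linProd, Finset.prod_range_add]
  congr 1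
  · exact linProd_congr fun a ha => by simp [polarSeq, ha]
  · exact Finset.prod_congr rfl fun a _ => by simp [polarSeq]

theorem dualPolarC_eq_coeff {q : ℕ} (hq : 1 < q) (e : ℝ) {d j i : ℕ} (hj : j ≤ d) (hi : i ≤ d) :
    dualPolarC q d e j i = (linProd (polarSeq q ((q : ℝ) ^ e) i) d).coeff j := by
  have hq' : (1 : ℝ) < q := by exact_mod_cast hq
  have hq0 : (0 : ℝ) < q := by linarith
  rw [linProd_polarSeq _ _ hi, coeff_mul, dualPolarC]
  -- The index h corresponds to taking degree i - h from the first factor and j + h - i from the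
  -- second; any other split exceeds the degree of a factor.
  refine Finset.sum_of_injOn (fun h => (i - h, j + h - i)) ?_ ?_ ?_ ?_
  · intro h hh h' hh' heq
    simp only [Finset.coe_Icc, Set.mem_Icc, le_min_iff, Prod.mk.injEq] at hh hh' heq
    omega
  · intro h hh
    simp only [Finset.coe_Icc, Set.mem_Icc, le_min_iff] at hh
    simp only [Finset.mem_coe, Finset.HasAntidiagonal.mem_antidiagonal]
    omega
  · rintro ⟨m, k⟩ hmk hn
    rw [Finset.HasAntidiagonal.mem_antidiagonal] at hmk
    dsimp only at hmk ⊢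
    rcases Nat.lt_or_ge i m with h1 | h1
    · rw [coeff_linProd_of_lt _ h1, zero_mul]
    rcases Nat.lt_or_ge (d - i) k with h2 | h2
    · rw [coeff_linProd_of_lt _ h2, mul_zero]
    refine absurd ⟨i - m, ?_, ?_⟩ hn
    · simp only [Finset.coe_Icc, Set.mem_Icc, le_min_iff]
      omega
    · simp only [Prod.mk.injEq]
      omega
  · intro h hh
    simp only [Finset.mem_Icc, le_min_iff] at hh
    rw [coeff_linProd_geom hq', coeff_linProd_geom hq', gaussBinom_symm hq' hh.2.2,
      show d - j - h = d - i - (j + h - i) by omega, gaussBinom_symm hq' (by omega),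
      Real.rpow_add hq0, Real.rpow_add hq0, Real.rpow_natCast, Real.rpow_natCast,
      mul_comm _ e, Real.rpow_mul hq0.le, Real.rpow_natCast]
    ring

/-! ### Comparison of rows -/

lemma coeff_linProd_geom_mul {q : ℝ} (hq : 1 < q) (s t : ℝ) (n k : ℕ) :
    (linProd (fun a => s * t * q ^ a) n).coeff k
      = s ^ k * (linProd (fun a => t * q ^ a) n).coeff k := by
  rw [coeff_linProd_geom hq, coeff_linProd_geom hq, mul_pow]
  ring

lemma coeff_polarSeq_self {q : ℝ} (hq : 1 < q) (t : ℝ) (d j : ℕ) :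
    (linProd (polarSeq q t d) d).coeff j = (-1) ^ j * (linProd (fun a => q ^ a) d).coeff j := by
  have h := coeff_linProd_geom_mul hq (-1) 1 d j
  simp only [one_mul, mul_one] at h
  rw [← h, linProd_polarSeq _ _ le_rfl, Nat.sub_self]
  simp [linProd]

lemma abs_coeff_polarSeq_self {q : ℝ} (hq : 1 < q) (t : ℝ) (d j : ℕ) :
    |(linProd (polarSeq q t d) d).coeff j| = (linProd (fun a => q ^ a) d).coeff j := by
  rw [coeff_polarSeq_self hq, abs_mul, abs_pow, abs_neg, abs_one, one_pow, one_mul,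
    abs_of_nonneg (coeff_linProd_nonneg (fun a _ => by positivity) j)]

/-- If `t ≤ q^i`, the coefficients for row `i` are dominated by those for the last row. -/
lemma abs_coeff_polarSeq_le {q t : ℝ} (hq : 1 < q) (ht : 0 ≤ t) {i : ℕ} (h : t ≤ q ^ i)
    (d j : ℕ) :
    |(linProd (polarSeq q t i) d).coeff j| ≤ (linProd (fun a => q ^ a) d).coeff j := by
  have hq0 : 0 < q := by linarith
  refine abs_coeff_linProd_le (fun a _ => ?_) j
  rw [polarSeq]
  split_ifs with ha
  · rw [abs_neg, abs_of_nonneg (by positivity)]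
  · rw [abs_of_nonneg (by positivity)]
    calc t * q ^ (a - i) ≤ q ^ i * q ^ (a - i) := by gcongr
      _ = q ^ a := by rw [← pow_add]; congr 1; omega

lemma coeff_polarSeq_one (q t : ℝ) (n k : ℕ) :
    (linProd (polarSeq q t 1) (n + 1)).coeff (k + 1)
      = (linProd (fun a => t * q ^ a) n).coeff (k + 1)
        - (linProd (fun a => t * q ^ a) n).coeff k := by
  rw [linProd_succ', coeff_mul_linear_succ]
  simp [polarSeq, sub_eq_add_neg]

/-- The ratio of consecutive coefficients in the `q`-binomial theorem. -/
lemma coeff_linProd_geom_succ {q : ℝ} (hq : 1 < q) (t : ℝ) {n k : ℕ} (h : k < n) :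
    (q ^ (k + 1) - 1) * (linProd (fun a => t * q ^ a) n).coeff (k + 1)
      = t * q ^ k * (q ^ (n - k) - 1) * (linProd (fun a => t * q ^ a) n).coeff k := by
  have h1 := coeff_linProd_geom_mul_qFac q t (n := n) (k := k) h.le
  have h2 := coeff_linProd_geom_mul_qFac q t (n := n) (k := k + 1) h
  obtain ⟨m, rfl⟩ : ∃ m, n = k + 1 + m := ⟨n - (k + 1), by omega⟩
  rw [show k + 1 + m - k = m + 1 by omega] at h1 ⊢
  rw [show k + 1 + m - (k + 1) = m by omega] at h2
  rw [Nat.choose_succ_succ' k 1, Nat.choose_one_right] at h2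
  rw [qFac_succ] at h1 h2
  refine mul_right_cancel₀ (mul_pos (qFac_pos hq k) (qFac_pos hq m)).ne' ?_
  linear_combination h2 - t * q ^ k * h1

/-- The ratio of the two coefficients is t q^k (q^(n-k) - 1) / (q^(k+1) - 1), where q^(n-k) - 1 ≥ 1
and t q^k ≥ 2 q^(k+1). -/
lemma two_mul_coeff_linProd_geom_le {q t : ℝ} (hq : 2 ≤ q) (ht : 2 * q ≤ t) {n k : ℕ}
    (h : k < n) :
    2 * (linProd (fun a => t * q ^ a) n).coeff k
      ≤ (linProd (fun a => t * q ^ a) n).coeff (k + 1) := by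
  have hq1 : 1 < q := by linarith
  have hE : 0 ≤ (linProd (fun a => t * q ^ a) n).coeff k :=
    coeff_linProd_nonneg (fun a _ => by have : 0 < t := by linarith
                                        positivity) k
  have hp : 0 < q ^ (k + 1) - 1 := sub_pos.2 (one_lt_pow₀ hq1 (by omega))
  refine le_of_mul_le_mul_left ?_ hp
  rw [coeff_linProd_geom_succ hq1 t h, ← mul_assoc]
  refine mul_le_mul_of_nonneg_right ?_ hE
  have h1 : q ≤ q ^ (n - k) := le_self_pow₀ hq1.le (by omega)
  have h2 : 0 < q ^ k := by positivity
  have h3 : 0 < t := by linarith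
  calc (q ^ (k + 1) - 1) * 2 ≤ 2 * q * q ^ k * 1 := by rw [pow_succ]; linarith
    _ ≤ t * q ^ k * (q ^ (n - k) - 1) := by gcongr; linarith

lemma coeff_one_linProd_geom_ge {q t : ℝ} (hq : 1 < q) (ht : 0 ≤ t) {n : ℕ} (h : 0 < n) :
    t ≤ (linProd (fun a => t * q ^ a) n).coeff 1 := by
  have h1 := coeff_linProd_geom_succ hq t h
  have h2 : q ≤ q ^ n := le_self_pow₀ hq.le h.ne'
  simp only [zero_add, pow_one, pow_zero, mul_one, Nat.sub_zero, coeff_linProd_zero] at h1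
  refine le_of_mul_le_mul_left ?_ (sub_pos.2 hq)
  rw [h1, mul_comm]
  gcongr

/-- If `t ≥ 2q` then row `1` dominates every later row. -/
lemma abs_coeff_polarSeq_le_one {q t : ℝ} (hq : 2 ≤ q) (ht : 2 * q ≤ t) {i : ℕ} (hi : 2 ≤ i)
    {n k : ℕ} (hn : 0 < n) (hk : k ≤ n) :
    |(linProd (polarSeq q t i) (n + 1)).coeff (k + 1)|
      ≤ |(linProd (polarSeq q t 1) (n + 1)).coeff (k + 1)| := by
  have hq1 : 1 < q := by linarith
  have ht0 : 0 < t := by linarith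
  set E := fun m => (linProd (fun a => t * q ^ a) n).coeff m with hEdef
  have hE : ∀ m, 0 ≤ E m := coeff_linProd_nonneg (fun a _ => by positivity)
  have hdom : |(linProd (polarSeq q t i) (n + 1)).coeff (k + 1)|
      ≤ (1 / 2) ^ (k + 1) * E (k + 1) + (1 / 2) ^ k * E k := by
    -- Beyond the first entry, row i has q^a ≤ (t/2) q^(a-1) as t ≥ 2q, or t q^(a-i) ≤ (t/2) q^(a-1)
    -- as i ≥ 2 and q ≥ 2.
    let z : ℕ → ℝ := fun a => if a = 0 then 1 else 1 / 2 * t * q ^ (a - 1)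
    refine (abs_coeff_linProd_le (y := z) (fun a _ => ?_) (k + 1)).trans_eq ?_
    · rcases Nat.eq_zero_or_pos a with rfl | ha
      · simp [z, polarSeq, show 0 < i by omega]
      obtain ⟨b, rfl⟩ : ∃ b, a = b + 1 := ⟨a - 1, by omega⟩
      simp only [z, polarSeq, Nat.add_sub_cancel, Nat.succ_ne_zero, if_false]
      split_ifs with hb
      · rw [abs_neg, abs_of_nonneg (by positivity), pow_succ]
        have : 0 < q ^ b := by positivity
        nlinarith
      · rw [abs_of_nonneg (by positivity)]
        have h1 : q ^ (b + 1 - i) * 2 ≤ q ^ b :=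
          calc q ^ (b + 1 - i) * 2 ≤ q ^ (b + 1 - i) * q := by gcongr
            _ = q ^ (b + 1 - i + 1) := (pow_succ _ _).symm
            _ ≤ q ^ b := pow_le_pow_right₀ hq1.le (by omega)
        nlinarith
    · rw [linProd_succ', coeff_mul_linear_succ]
      simp only [z, Nat.succ_ne_zero, if_false, if_true, Nat.add_sub_cancel, one_mul]
      rw [coeff_linProd_geom_mul hq1, coeff_linProd_geom_mul hq1]
  rw [coeff_polarSeq_one]
  refine hdom.trans ?_
  change _ ≤ |E (k + 1) - E k|
  rcases hk.eq_or_lt with rfl | hk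
  · rw [show E (k + 1) = 0 from coeff_linProd_of_lt _ (Nat.lt_succ_self k), mul_zero, zero_add,
      zero_sub, abs_neg, abs_of_nonneg (hE k)]
    exact mul_le_of_le_one_left (hE k) (pow_le_one₀ (by norm_num) (by norm_num))
  refine le_trans ?_ (le_abs_self _)
  rcases Nat.eq_zero_or_pos k with rfl | hk0
  -- Here E 1 / 2 + 1 ≤ E 1 - 1 is needed, and E 1 ≥ t ≥ 2q ≥ 4.
  · have h1 : t ≤ E 1 := coeff_one_linProd_geom_ge hq1 ht0.le hn
    have h0 : E 0 = 1 := coeff_linProd_zero _ _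
    norm_num [h0]
    linarith
  · have h2 : 2 * E k ≤ E (k + 1) := two_mul_coeff_linProd_geom_le hq ht hk
    have hp : (1 / 2 : ℝ) ^ k ≤ 1 / 2 := pow_le_of_le_one (by norm_num) (by norm_num) hk0.ne'
    have h3 := mul_le_mul_of_nonneg_right hp (hE k)
    have h4 := mul_le_mul_of_nonneg_right hp (hE (k + 1))
    rw [pow_succ]
    linarith

lemma IsPolarParameter.one_lt {q : ℕ} {e : ℝ} (h : IsPolarParameter q e) : 1 < q := h.1.one_lt

lemma IsPolarParameter.rpow_le_sq {q : ℕ} {e : ℝ} (h : IsPolarParameter q e) :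
    (q : ℝ) ^ e ≤ (q : ℝ) ^ 2 := by
  have hq : (1 : ℝ) ≤ q := by exact_mod_cast h.one_lt.le
  rw [← Real.rpow_natCast]
  refine Real.rpow_le_rpow_of_exponent_le hq ?_
  rcases h.2.1 with h | h | h | h | h <;> rw [h] <;> norm_num

/-- For e = 3/2 squareness is essential: q = s^2 with s ≥ 2 gives s^3 ≥ 2 s^2, whereas q = 2 and q =
3 would fail. -/
lemma IsPolarParameter.two_mul_le_rpow {q : ℕ} {e : ℝ} (h : IsPolarParameter q e) (he : 1 < e) :
    2 * (q : ℝ) ≤ (q : ℝ) ^ e := by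
  have hq2 : (2 : ℝ) ≤ q := by exact_mod_cast h.one_lt
  rcases h.2.1 with h' | h' | h' | h' | h'
  · linarith
  · rw [h'] at he; norm_num at he
  · linarith
  · obtain ⟨s, hs⟩ := h.2.2 (Or.inr h')
    have hs2 : 2 ≤ s := by
      have := h.one_lt
      by_contra! hlt
      interval_cases s <;> omega
    have hs' : (2 : ℝ) ≤ s := by exact_mod_cast hs2
    have hqs : (q : ℝ) = (s : ℝ) ^ (2 : ℝ) := by rw [hs]; push_cast; norm_num; ring
    rw [h', hqs, ← Real.rpow_mul (by positivity)]
    norm_num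
    nlinarith [sq_nonneg (s : ℝ)]
  · rw [h', Real.rpow_two]
    nlinarith

theorem mainTheorem7 (q : ℕ) (e : ℝ) (hqe : IsPolarParameter q e)
    (d j : ℕ) (hd : 3 ≤ d) (hj1 : 1 ≤ j) (hjd : j ≤ d) :
    (1 < e ∨ (j = d ∧ e = 1) →
      IsGreatest ((fun i : ℕ => |dualPolarC q d e j i|) '' Set.Icc 1 d)
        |dualPolarC q d e j 1|) ∧
    (e ≤ 1 →
      IsGreatest ((fun i : ℕ => |dualPolarC q d e j i|) '' Set.Icc 1 d)
        |dualPolarC q d e j d|) ∧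
    (j < d → Odd j →
      IsLeast ((fun i : ℕ => dualPolarC q d e j i) '' Set.Icc 0 d)
        (dualPolarC q d e j d)) := by
  have hq := hqe.one_lt
  have hq1 : (1 : ℝ) < q := by exact_mod_cast hq
  have hq2 : (2 : ℝ) ≤ q := by exact_mod_cast hq
  have hC : ∀ i ≤ d, dualPolarC q d e j i = (linProd (polarSeq q ((q : ℝ) ^ e) i) d).coeff j :=
    fun i hi => dualPolarC_eq_coeff hq e hjd hi
  have ht0 : 0 < (q : ℝ) ^ e := Real.rpow_pos_of_pos (by linarith) e
  have hlast : ∀ i, 1 ≤ i → i ≤ d → e ≤ 1 → |dualPolarC q d e j i| ≤ |dualPolarC q d e j d| := by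
    intro i h1 hi he
    rw [hC i hi, hC d le_rfl, abs_coeff_polarSeq_self hq1]
    refine abs_coeff_polarSeq_le hq1 ht0.le ?_ d j
    calc (q : ℝ) ^ e ≤ (q : ℝ) ^ (1 : ℝ) := Real.rpow_le_rpow_of_exponent_le hq1.le he
      _ = q := Real.rpow_one _
      _ ≤ (q : ℝ) ^ i := le_self_pow₀ hq1.le (by omega)
  obtain ⟨n, rfl⟩ : ∃ n, d = n + 1 := ⟨d - 1, by omega⟩
  obtain ⟨k, rfl⟩ : ∃ k, j = k + 1 := ⟨j - 1, by omega⟩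
  refine ⟨fun he => ⟨⟨1, ⟨le_rfl, by omega⟩, rfl⟩, ?_⟩,
    fun he => ⟨⟨n + 1, ⟨by omega, le_rfl⟩, rfl⟩, ?_⟩,
    fun hj hodd => ⟨⟨n + 1, ⟨by omega, le_rfl⟩, rfl⟩, ?_⟩⟩
  · rintro _ ⟨i, ⟨h1, hi⟩, rfl⟩
    dsimp only
    rcases he with he | ⟨hkn, he⟩
    · rcases h1.eq_or_lt with rfl | h1
      · rfl
      · rw [hC i hi, hC 1 (by omega)]
        exact abs_coeff_polarSeq_le_one hq2 (hqe.two_mul_le_rpow he) h1 (by omega) (by omega)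
    -- For j = d the coefficient is the product of all entries; when t = q, rows 1 and d agree up to
    -- signs.
    · refine (hlast i h1 hi he.le).trans_eq ?_
      obtain rfl : k = n := by omega
      rw [hC _ le_rfl, hC 1 (by omega), abs_coeff_polarSeq_self hq1, coeff_polarSeq_one,
        coeff_linProd_of_lt _ (Nat.lt_succ_self k), zero_sub, abs_neg, he, Real.rpow_one,
        abs_of_nonneg (coeff_linProd_nonneg (fun a _ => by positivity) k),
        linProd_succ', coeff_mul_linear_succ, coeff_linProd_of_lt _ (Nat.lt_succ_self k)]
      simp only [pow_zero, one_mul, zero_add, pow_succ']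
  · rintro _ ⟨i, ⟨h1, hi⟩, rfl⟩
    exact hlast i h1 hi he
  · rintro _ ⟨i, ⟨-, hi⟩, rfl⟩
    dsimp only
    have hneg : dualPolarC q (n + 1) e (k + 1) (n + 1)
        = -(linProd (fun a => (q : ℝ) ^ a) (n + 1)).coeff (k + 1) := by
      rw [hC _ le_rfl, coeff_polarSeq_self hq1, hodd.neg_one_pow, neg_one_mul]
    have hpos : dualPolarC q (n + 1) e (k + 1) (n + 1) ≤ 0 := by
      rw [hneg, neg_nonpos]
      exact coeff_linProd_nonneg (fun a _ => by positivity) _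
    rcases Nat.lt_or_ge i 2 with h2 | h2
    · interval_cases i
      · refine hpos.trans ?_
        rw [hC 0 (by omega)]
        exact coeff_linProd_nonneg (fun a _ => by simp only [polarSeq, not_lt_zero, if_false]; positivity) _
      · rcases le_or_gt e 1 with he | he
        · have := hlast 1 le_rfl (by omega) he
          rw [abs_of_nonpos hpos] at this
          linarith [neg_le_of_abs_le this]
        · refine hpos.trans ?_
          rw [hC 1 (by omega), coeff_polarSeq_one]
          have h3 := two_mul_coeff_linProd_geom_le hq2 (hqe.two_mul_le_rpow he)
            (show k < n by omega)
          have h4 : 0 ≤ (linProd (fun a => (q : ℝ) ^ e * (q : ℝ) ^ a) n).coeff k :=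
            coeff_linProd_nonneg (fun a _ => by positivity) k
          linarith
    · rw [hneg, hC i hi]
      exact neg_le_of_abs_le (abs_coeff_polarSeq_le hq1 ht0.le
        (hqe.rpow_le_sq.trans (pow_le_pow_right₀ hq1.le h2)) _ _)
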